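/- Let $n\ge 0$, let $G$ be a finite simple graph on the vertex set $\{1,\dots,n\}$, and let $\mathbb K$ be a field. Let $J_G\subset \mathbb K[X_1,\dots,X_n,Y_1,\dots,Y_n]$ be the binomial edge ideal of $G$, generated by the binomials $X_iY_j-X_jY_i$ for all edges $\{i,j\}$ of $G$ with $i<j$. A \emph{semi-path} of $G$ is a subgraph $P$ of $G$ (not necessarily induced or spanning) each of whose connected components is a path, a single vertex counting as a path. Let $r(G)$ be the maximum of $|E(P)|$ over all semi-paths $P$ of $G$. For a graph $H$, let $\widehat H$ be the graph obtained from $H$ by deleting its isolated vertices. We say that $G$ is of \emph{K\"onig type} if $r(G)=\operatorname{ht}(J_G)$. Then $G$ is of K\"onig type if and only if there exist a semi-path $P$ of $G$ and a (possibly empty) set $T\subset V(G)$ of vertices such that \begin{enumerate} \item $|E(P)|=r(G)$; \item every $v\in T$ has degree two in $P$; \item for all $v,w\in T$, $\{v,w\}$ is not an edge of $P$; \item $\widehat{G\setminus T}$ and $\widehat{P\setminus T}$ have the same number of connected components and the same number of vertices, where $G\setminus T$ and $P\setminus T$ are obtained from $G$ and $P$ by deleting the vertices in $T$. \end{enumerate}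 -/

import Mathlib

/-- The binomial edge ideal `J_G` of a graph `G` over the field `K`: the ideal of
`K[X_v, Y_v : v ∈ V]` generated by the binomials `X_i Y_j - X_j Y_i` for the edges `{i, j}` of `G`
with `i < j`. The variable `X_v` is indexed by `Sum.inl v` and `Y_v` by `Sum.inr v`. -/
noncomputable def binomialEdgeIdeal (K : Type*) [Field K] {V : Type*} [LinearOrder V] (G : SimpleGraph V) :
    Ideal (MvPolynomial (V ⊕ V) K) :=
  Ideal.span {f | ∃ i j : V, i < j ∧ G.Adj i j ∧
    f = MvPolynomial.X (Sum.inl i) * MvPolynomial.X (Sum.inr j) -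
        MvPolynomial.X (Sum.inl j) * MvPolynomial.X (Sum.inr i)}

/-- A semi-path of `G`: a subgraph each of whose connected components is a path
(a single vertex counts as a path). -/
def IsSemiPath {V : Type*} {G : SimpleGraph V} (P : G.Subgraph) : Prop :=
  ∀ c : P.coe.ConnectedComponent, ∃ k : ℕ,
    Nonempty (c.toSimpleGraph ≃g SimpleGraph.pathGraph k)

/-- `r(G)`: the supremum of the numbers of edges of the semi-paths of `G`. -/
noncomputable def pathPackingNumber {V : Type*} (G : SimpleGraph V) : ℕ :=
  sSup {m : ℕ | ∃ P : G.Subgraph, IsSemiPath P ∧ m = P.edgeSet.ncard}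

/-- The supremum defining `r(G)` is over a nonempty set. -/
theorem pathPackingNumber_set_nonempty {V : Type*} (G : SimpleGraph V) :
    {m : ℕ | ∃ P : G.Subgraph, IsSemiPath P ∧ m = P.edgeSet.ncard}.Nonempty := by
  refine ⟨_, ⊥, ?_, rfl⟩
  intro c
  induction c using SimpleGraph.ConnectedComponent.ind with
  | h v => exact (Set.notMem_empty _ v.2).elim

/-- For a finite graph, the supremum defining `r(G)` is over a bounded set. -/
theorem pathPackingNumber_set_bddAbove {V : Type*} [Finite V] (G : SimpleGraph V) :
    BddAbove {m : ℕ | ∃ P : G.Subgraph, IsSemiPath P ∧ m = P.edgeSet.ncard} := by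
  refine ⟨G.edgeSet.ncard, ?_⟩
  rintro m ⟨P, -, rfl⟩
  exact Set.ncard_le_ncard P.edgeSet_subset (Set.toFinite _)

/-- `G` is of König type (over `K`) if `r(G)` equals the height of `J_G`. -/
def IsKonigType (K : Type*) [Field K] {V : Type*} [LinearOrder V] (G : SimpleGraph V) : Prop :=
  (pathPackingNumber G : ℕ∞) = (binomialEdgeIdeal K G).height

/-- The graph obtained from `H` by removing its isolated vertices: the induced subgraph on the
set of non-isolated vertices. -/
abbrev removeIsolated {W : Type*} (H : SimpleGraph W) :
    SimpleGraph {w : W | ¬ H.IsIsolated w} :=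
  H.induce {w : W | ¬ H.IsIsolated w}

/-- The number of vertices of `H` that are not isolated in `H`, i.e. the number of vertices of
`removeIsolated H`. -/
noncomputable def numNonisolatedVertices {W : Type*} (H : SimpleGraph W) : ℕ :=
  Nat.card {w : W | ¬ H.IsIsolated w}

/-- The number of connected components of `removeIsolated H`. -/
noncomputable def numNonisolatedComponents {W : Type*} (H : SimpleGraph W) : ℕ :=
  Nat.card (removeIsolated H).ConnectedComponent

/-! Write `c(H)` for the number of components and `n` for the number of vertices. The height of
`J_G` is the minimum over vertex sets `S` of `n + |S| - c(G ∖ S)`, while every semi-path `P` and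
every `T` satisfy `|E(P)| ≤ n + |T| - c(G ∖ T)`. Hence `r(G) ≤ ht J_G`, and equality means that some
maximum semi-path and some `T` give equality in the second bound; this equality case is exactly the
combinatorial condition.

Height: if `f` sends each vertex outside `S` to a representative of its component in `G ∖ S` and
fixes `S`, the kernel of `blockSubst K f S S` is a prime containing `J_G`. Its height is bounded
below by a strict chain of such kernels (`le_height_ker_blockSubst`) and above by Krull's height
theorem (`height_binomialEdgeIdeal_add_le`). Conversely, each prime containing `J_G` contains one of
these kernels (`exists_card_add_le_height_add_of_isPrime`).

Count (`IsSemiPath.ncard_edgeSet_add_card_le`): `P`, extended by isolated vertices, is a forest of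
maximum degree at most two. So `n - |T| - c(P ∖ T)` of its edges avoid `T`, at most `2|T|` meet `T`,
and `c(P ∖ T) ≥ c(G ∖ T)`. Equality forces degree two on `T`, independence of `T` in `P`, and equal
component counts. -/

/-! ### Kernels of block substitutions and chains of primes. -/

section BlockSubstitution

open MvPolynomial

variable {K : Type*} [Field K] {V : Type*}

/-- The substitution `X_v ↦ t_v a_{f v}`, `Y_v ↦ t_v b_{f v}`, except that `X_v ↦ 0` for `v ∈ A`
and `Y_v ↦ 0` for `v ∈ B`. Its values are polynomials in variables `t`, `a`, `b`. -/
noncomputable def blockSubst (K : Type*) [Field K] {V : Type*} [DecidableEq V] (f : V → V)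
    (A B : Finset V) : MvPolynomial (V ⊕ V) K →ₐ[K] MvPolynomial (V ⊕ V ⊕ V) K :=
  aeval (Sum.elim
    (fun v => if v ∈ A then 0 else X (Sum.inl v) * X (Sum.inr (Sum.inl (f v))))
    (fun v => if v ∈ B then 0 else X (Sum.inl v) * X (Sum.inr (Sum.inr (f v)))))

section

variable [DecidableEq V] (f : V → V) (A B : Finset V)

theorem blockSubst_X_inl (v : V) : blockSubst K f A B (X (Sum.inl v)) =
    if v ∈ A then 0 else X (Sum.inl v) * X (Sum.inr (Sum.inl (f v))) := by
  simp [blockSubst]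

theorem blockSubst_X_inr (v : V) : blockSubst K f A B (X (Sum.inr v)) =
    if v ∈ B then 0 else X (Sum.inl v) * X (Sum.inr (Sum.inr (f v))) := by
  simp [blockSubst]

variable {f A B}

theorem ker_lt_ker_of_comp {R S T : Type*} [CommRing R] [CommRing S] [CommRing T] [Algebra K R]
    [Algebra K S] [Algebra K T] {φ : R →ₐ[K] S} {ψ : R →ₐ[K] T} (g : S →ₐ[K] T)
    (hg : ψ = g.comp φ) {x : R} (hx : ψ x = 0) (hx' : φ x ≠ 0) :
    RingHom.ker φ < RingHom.ker ψ := by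
  refine lt_of_le_of_ne (fun y hy => ?_) fun h => hx' ?_
  · rw [RingHom.mem_ker] at hy ⊢
    rw [hg, AlgHom.comp_apply, hy, map_zero]
  · rw [← RingHom.mem_ker, h, RingHom.mem_ker, hx]

/-- One link of a chain of primes: specialising a parametrisation further, so that a new element `x`
vanishes, raises the height of the kernel. -/
theorem height_ker_add_one_le {R S T : Type*} [CommRing R] [CommRing S] [CommRing T] [Algebra K R]
    [Algebra K S] [Algebra K T] [IsDomain S] [IsDomain T] {φ : R →ₐ[K] S} {ψ : R →ₐ[K] T}
    (g : S →ₐ[K] T) (hg : ψ = g.comp φ) {x : R} (hx : ψ x = 0) (hx' : φ x ≠ 0) :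
    (RingHom.ker φ).height + 1 ≤ (RingHom.ker ψ).height := by
  have := RingHom.ker_isPrime φ
  have := RingHom.ker_isPrime ψ
  exact Ideal.height_add_one_le_of_lt_of_isPrime (ker_lt_ker_of_comp g hg hx hx')

/-- Since `v` is alone in its block, setting `a_{f v}` to zero kills the image of `X_v` and changes
no other image. -/
theorem le_height_ker_blockSubst_insert_left {v : V} (hv : v ∉ A) (hf : ∀ w, f w = f v → w = v) :
    (RingHom.ker (blockSubst K f A B)).height + 1 ≤
      (RingHom.ker (blockSubst K f (insert v A) B)).height := by
  refine height_ker_add_one_le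
    (aeval (fun i => if i = Sum.inr (Sum.inl (f v)) then 0 else X i)) ?_ (x := X (Sum.inl v)) ?_ ?_
  · apply algHom_ext
    rintro (w | w)
    · rw [AlgHom.comp_apply, blockSubst_X_inl, blockSubst_X_inl]
      by_cases h : w = v
      · subst h; simp [hv]
      · have : f w ≠ f v := fun h' => h (hf w h')
        by_cases hA : w ∈ A <;> simp [h, hA, this]
    · rw [AlgHom.comp_apply, blockSubst_X_inr, blockSubst_X_inr]
      by_cases hB : w ∈ B <;> simp [hB]
  · simp [blockSubst_X_inl]
  · simp [blockSubst_X_inl, hv, X_ne_zero]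

theorem le_height_ker_blockSubst_insert_right {v : V} (hv : v ∉ B) (hf : ∀ w, f w = f v → w = v) :
    (RingHom.ker (blockSubst K f A B)).height + 1 ≤
      (RingHom.ker (blockSubst K f A (insert v B))).height := by
  refine height_ker_add_one_le
    (aeval (fun i => if i = Sum.inr (Sum.inr (f v)) then 0 else X i)) ?_ (x := X (Sum.inr v)) ?_ ?_
  · apply algHom_ext
    rintro (w | w)
    · rw [AlgHom.comp_apply, blockSubst_X_inl, blockSubst_X_inl]
      by_cases hB : w ∈ A <;> simp [hB]
    · rw [AlgHom.comp_apply, blockSubst_X_inr, blockSubst_X_inr]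
      by_cases h : w = v
      · subst h; simp [hv]
      · have : f w ≠ f v := fun h' => h (hf w h')
        by_cases hA : w ∈ B <;> simp [h, hA, this]
  · simp [blockSubst_X_inr]
  · simp [blockSubst_X_inr, hv, X_ne_zero]

theorem mul_X_sub_ne_zero {i j p q : V} (hpq : p ≠ q) :
    (X (Sum.inl i) * X (Sum.inr (Sum.inl p)) * (X (Sum.inl j) * X (Sum.inr (Sum.inr q))) -
      X (Sum.inl j) * X (Sum.inr (Sum.inl q)) * (X (Sum.inl i) * X (Sum.inr (Sum.inr p))) :
      MvPolynomial (V ⊕ V ⊕ V) K) ≠ 0 := by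
  intro h
  -- Evaluate at `t = 1`, with `a` the indicator of `p` and `b` the indicator of `q`: the first
  -- product becomes 1 and the second 0.
  have := congrArg (aeval (R := K) (S₁ := K) (fun s : V ⊕ V ⊕ V =>
    Sum.elim (fun _ => 1) (Sum.elim (fun c => if c = p then 1 else 0)
      (fun c => if c = q then 1 else 0)) s)) h
  simp [hpq] at this

/-- Merging blocks one at a time produces a chain of primes. -/
theorem le_height_ker_blockSubst_empty [Finite V] (f : V → V) :
    (Nat.card V : ℕ∞) ≤ (RingHom.ker (blockSubst K f ∅ ∅)).height + (Set.range f).ncard := by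
  induction hm : Nat.card V - (Set.range f).ncard generalizing f with
  | zero =>
    have : Nat.card V ≤ (Set.range f).ncard := by omega
    exact (Nat.cast_le.2 this).trans le_add_self
  | succ m ih =>
    have hlt : (Set.range f).ncard < Nat.card V := by omega
    have hsurj : ¬ f.Surjective := fun h => by
      rw [h.range_eq, Set.ncard_univ] at hlt
      exact lt_irrefl _ hlt
    have hinj : ¬ f.Injective := fun h => hsurj (Finite.injective_iff_surjective.1 h)
    simp only [Function.Injective, not_forall] at hinj
    obtain ⟨i, j, hij, hne⟩ := hinj
    simp only [Function.Surjective, not_forall, not_exists] at hsurj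
    obtain ⟨c, hc⟩ := hsurj
    -- Sending `i` to the unused label `c` splits it off its block; the old label stays in the range
    -- because of `j`.
    have hrange : Set.range (Function.update f i c) = insert c (Set.range f) := by
      ext y
      constructor
      · rintro ⟨x, rfl⟩
        by_cases hx : x = i
        · subst hx; simp
        · simp [hx]
      · rintro (rfl | ⟨x, rfl⟩)
        · exact ⟨i, by simp⟩
        · by_cases hx : x = i
          · subst hx; exact ⟨j, by simp [Ne.symm hne, hij]⟩
          · exact ⟨x, by simp [hx]⟩
    have hcard : (Set.range (Function.update f i c)).ncard = (Set.range f).ncard + 1 := by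
      rw [hrange, Set.ncard_insert_of_notMem (by rintro ⟨x, hx⟩; exact hc x hx)]
    have key : (RingHom.ker (blockSubst K (Function.update f i c) ∅ ∅)).height + 1 ≤
        (RingHom.ker (blockSubst K f ∅ ∅)).height := by
      -- Renaming `c` back to `f i` merges the blocks again; the binomial of `i` and `j` vanishes
      -- only after merging.
      refine height_ker_add_one_le (rename (Sum.map id (Sum.map
        (fun x => if x = c then f i else x) (fun x => if x = c then f i else x)))) ?_
        (x := X (Sum.inl i) * X (Sum.inr j) - X (Sum.inl j) * X (Sum.inr i)) ?_ ?_
      · apply algHom_ext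
        rintro (w | w)
        · rw [AlgHom.comp_apply, blockSubst_X_inl, blockSubst_X_inl]
          by_cases h : w = i
          · subst h; simp
          · simp [h, hc w]
        · rw [AlgHom.comp_apply, blockSubst_X_inr, blockSubst_X_inr]
          by_cases h : w = i
          · subst h; simp
          · simp [h, hc w]
      · simp only [map_sub, map_mul, blockSubst_X_inl, blockSubst_X_inr, Finset.notMem_empty,
          if_false, hij]
        ring
      · simp only [map_sub, map_mul, blockSubst_X_inl, blockSubst_X_inr, Finset.notMem_empty,
          if_false]
        exact mul_X_sub_ne_zero (by simp [Ne.symm hne, Ne.symm (hc j)])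
    have h1 := ih (Function.update f i c) (by omega)
    rw [hcard] at h1
    calc (Nat.card V : ℕ∞) ≤ _ := h1
      _ = (RingHom.ker (blockSubst K (Function.update f i c) ∅ ∅)).height + 1 +
          (Set.range f).ncard := by push_cast; ring
      _ ≤ _ := by gcongr

/-- The chain that merges blocks is prolonged by `2|S|` links, killing first the `X_v` and then the
`Y_v` for `v ∈ S`, one at a time. -/
theorem le_height_ker_blockSubst [Finite V] (f : V → V) (S : Finset V)
    (hS : ∀ v ∈ S, ∀ w, f w = f v → w = v) :
    (Nat.card V + 2 * S.card : ℕ∞) ≤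
      (RingHom.ker (blockSubst K f S S)).height + (Set.range f).ncard := by
  have hA : ∀ A ⊆ S, (Nat.card V + A.card : ℕ∞) ≤
      (RingHom.ker (blockSubst K f A ∅)).height + (Set.range f).ncard := by
    intro A
    induction A using Finset.induction_on with
    | empty => intro _; simpa using le_height_ker_blockSubst_empty (K := K) f
    | insert v A hv ih =>
      intro h
      rw [Finset.insert_subset_iff] at h
      have h1 := ih h.2
      have h2 := le_height_ker_blockSubst_insert_left (K := K) (B := ∅) hv (hS v h.1)
      rw [Finset.card_insert_of_notMem hv]
      calc _ = (Nat.card V + A.card : ℕ∞) + 1 := by push_cast; ring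
        _ ≤ (RingHom.ker (blockSubst K f A ∅)).height + (Set.range f).ncard + 1 := by gcongr
        _ = (RingHom.ker (blockSubst K f A ∅)).height + 1 + (Set.range f).ncard := by ring
        _ ≤ _ := by gcongr
  have hB : ∀ B ⊆ S, (Nat.card V + S.card + B.card : ℕ∞) ≤
      (RingHom.ker (blockSubst K f S B)).height + (Set.range f).ncard := by
    intro B
    induction B using Finset.induction_on with
    | empty => intro _; simpa using hA S le_rfl
    | insert v B hv ih =>
      intro h
      rw [Finset.insert_subset_iff] at h
      have h1 := ih h.2
      have h2 := le_height_ker_blockSubst_insert_right (K := K) (A := S) hv (hS v h.1)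
      rw [Finset.card_insert_of_notMem hv]
      calc _ = (Nat.card V + S.card + B.card : ℕ∞) + 1 := by push_cast; ring
        _ ≤ (RingHom.ker (blockSubst K f S B)).height + (Set.range f).ncard + 1 := by gcongr
        _ = (RingHom.ker (blockSubst K f S B)).height + 1 + (Set.range f).ncard := by ring
        _ ≤ _ := by gcongr
  calc _ = (Nat.card V + S.card + S.card : ℕ∞) := by ring
    _ ≤ _ := hB S le_rfl

/-- A prime containing `X_v, Y_v` for `v ∈ S` and over whose residue field the remaining vectors
`(x_v, y_v)` are proportional to nonzero vectors `(a_{f v}, b_{f v})` contains the kernel of the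
block substitution. -/
theorem ker_blockSubst_le {L : Type*} [CommRing L] [Algebra K L] (S : Finset V)
    (φ : MvPolynomial (V ⊕ V) K →ₐ[K] L) (hS : ∀ v ∈ S, φ (X (Sum.inl v)) = 0 ∧
      φ (X (Sum.inr v)) = 0) (t a b : V → L)
    (h : ∀ v ∉ S, φ (X (Sum.inl v)) = t v * a (f v) ∧ φ (X (Sum.inr v)) = t v * b (f v)) :
    RingHom.ker (blockSubst K f S S) ≤ RingHom.ker φ := by
  have hφ : φ = (aeval (Sum.elim t (Sum.elim a b))).comp (blockSubst K f S S) := by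
    apply algHom_ext
    rintro (w | w)
    · rw [AlgHom.comp_apply, blockSubst_X_inl]
      by_cases hw : w ∈ S
      · simp [hw, hS w hw]
      · simp [hw, h w hw]
    · rw [AlgHom.comp_apply, blockSubst_X_inr]
      by_cases hw : w ∈ S
      · simp [hw, hS w hw]
      · simp [hw, h w hw]
  intro x hx
  rw [RingHom.mem_ker] at hx ⊢
  rw [hφ, AlgHom.comp_apply, hx, map_zero]

end

theorem exists_smul_of_mul_eq_mul {L : Type*} [Field L] {p q x y : L} (hpq : p ≠ 0 ∨ q ≠ 0)
    (h : p * y = x * q) : ∃ t, x = t * p ∧ y = t * q := by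
  rcases hpq with hp | hq
  · refine ⟨x / p, by field_simp, ?_⟩
    field_simp
    linear_combination h
  · refine ⟨y / q, ?_, by field_simp⟩
    field_simp
    linear_combination -h

end BlockSubstitution

/-! ### Forests and placements on number lines. -/

namespace SimpleGraph

variable {V : Type*} {H : SimpleGraph V}

/-- A graph is acyclic if its vertices can be placed injectively on disjoint number lines such that
adjacent vertices are consecutive points of the same line. -/
theorem isAcyclic_of_injective_consecutive {α : Type*} (φ : V → α × ℕ) (hφ : φ.Injective)
    (hadj : ∀ u v, H.Adj u v → (φ u).1 = (φ v).1 ∧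
      ((φ u).2 + 1 = (φ v).2 ∨ (φ v).2 + 1 = (φ u).2)) : H.IsAcyclic := by
  have key : ∀ u v, H.Adj u v → (φ u).2 + 1 = (φ v).2 → H.IsBridge s(u, v) := by
    intro u v huv hpos
    rw [isBridge_iff]
    rintro ⟨w⟩
    -- By injectivity, the only edge leaving the part of the line up to `u` is the deleted one, so
    -- no remaining walk gets from `u` to `v`.
    have inv : ∀ {a b : V}, (H.deleteEdges {s(u, v)}).Walk a b →
        ((φ a).1 = (φ u).1 ∧ (φ a).2 ≤ (φ u).2) → ((φ b).1 = (φ u).1 ∧ (φ b).2 ≤ (φ u).2) := by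
      intro a b p
      induction p with
      | nil => exact id
      | @cons a c b h p ih =>
        rintro ⟨h1, h2⟩
        apply ih
        rw [deleteEdges_adj] at h
        obtain ⟨h, hne⟩ := h
        obtain ⟨h3, h4⟩ := hadj _ _ h
        refine ⟨h3 ▸ h1, ?_⟩
        by_contra hlt
        have e1 : (φ a).2 = (φ u).2 := by omega
        have e2 : (φ c).2 = (φ v).2 := by omega
        have ea : a = u := hφ (Prod.ext h1 e1)
        have ec : c = v := hφ (Prod.ext (h3.symm.trans (h1.trans (hadj _ _ huv).1)) e2)
        exact hne (by simp [ea, ec])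
    have := (inv w ⟨rfl, le_rfl⟩).2
    omega
  rw [isAcyclic_iff_forall_isBridge]
  intro e
  induction e with
  | h u v =>
    intro huv
    rcases (hadj u v huv).2 with h | h
    · exact key u v huv h
    · rw [Sym2.eq_swap]
      exact key v u huv.symm h

theorem ncard_neighborSet_le_two_of_injective_consecutive {α : Type*} (φ : V → α × ℕ)
    (hφ : φ.Injective) (hadj : ∀ u v, H.Adj u v → (φ u).1 = (φ v).1 ∧
      ((φ u).2 + 1 = (φ v).2 ∨ (φ v).2 + 1 = (φ u).2)) (v : V) :
    (H.neighborSet v).ncard ≤ 2 := by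
  have hsub : φ '' H.neighborSet v ⊆ {((φ v).1, (φ v).2 + 1), ((φ v).1, (φ v).2 - 1)} := by
    rintro _ ⟨u, hu, rfl⟩
    obtain ⟨h1, h2⟩ := hadj v u hu
    rcases h2 with h2 | h2
    · left; exact Prod.ext h1.symm h2.symm
    · right; exact Prod.ext h1.symm (by simp; omega)
  rw [← Set.ncard_image_of_injective _ hφ]
  exact (Set.ncard_le_ncard hsub (Set.toFinite _)).trans ((Set.ncard_insert_le _ _).trans (by simp))

/-- A forest has as many edges as it has vertices that are not chosen as roots of components. -/
theorem IsAcyclic.ncard_edgeSet_add_card_connectedComponent [Finite V] (hH : H.IsAcyclic) :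
    H.edgeSet.ncard + Nat.card H.ConnectedComponent = Nat.card V := by
  classical
  have := Fintype.ofFinite V
  have hdeg : ∀ (c : H.ConnectedComponent) (x : c), c.toSimpleGraph.degree x = H.degree x.1 := by
    intro c x
    rw [← card_neighborFinset_eq_degree, ← card_neighborFinset_eq_degree]
    apply Finset.card_bij (fun y _ => y.1)
    · intro y hy
      rw [mem_neighborFinset] at hy ⊢
      exact hy
    · intro a _ b _ h
      exact Subtype.ext h
    · intro b hb
      rw [mem_neighborFinset] at hb
      refine ⟨⟨b, c.mem_supp_of_adj_mem_supp x.2 hb⟩, ?_, rfl⟩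
      rw [mem_neighborFinset]
      exact hb
  -- Each component is a tree, with one edge fewer than vertices; the handshake lemma turns this
  -- into degree sums, which add up over components.
  have hc : ∀ c : H.ConnectedComponent, ∑ x : c, H.degree x.1 + 2 = 2 * Fintype.card c := by
    intro c
    have h1 := (hH.isTree_connectedComponent c).card_edgeFinset
    have h2 := c.toSimpleGraph.sum_degrees_eq_twice_card_edges
    simp only [hdeg] at h2
    rw [h2, ← h1, mul_add]
  let e : (Σ c : H.ConnectedComponent, c) ≃ V :=
    { toFun := fun x => x.2.1
      invFun := fun v => ⟨H.connectedComponentMk v, v, rfl⟩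
      left_inv := by rintro ⟨c, v, rfl⟩; rfl
      right_inv := fun v => rfl }
  have h1 : ∑ v, H.degree v = ∑ c : H.ConnectedComponent, ∑ x : c, H.degree x.1 := by
    rw [← Fintype.sum_sigma', ← e.sum_comp]
    rfl
  have h2 : Fintype.card V = ∑ c : H.ConnectedComponent, Fintype.card c := by
    rw [← Fintype.card_sigma]; exact (Fintype.card_congr e).symm
  have h3 : ∑ v, H.degree v + 2 * Fintype.card H.ConnectedComponent = 2 * Fintype.card V := by
    rw [h1, h2, Finset.mul_sum, ← Finset.sum_congr rfl (fun c _ => hc c), Finset.sum_add_distrib]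
    simp [mul_comm]
  rw [H.sum_degrees_eq_twice_card_edges] at h3
  rw [Nat.card_eq_fintype_card, Nat.card_eq_fintype_card, ← coe_edgeFinset, Set.ncard_coe_finset]
  omega

end SimpleGraph

/-! ### Components and isolated vertices. -/

open SimpleGraph

/-- The components of `H` are those of `removeIsolated H` and the isolated vertices. -/
theorem numNonisolatedComponents_add_card {W : Type*} [Finite W] (H : SimpleGraph W) :
    numNonisolatedComponents H + Nat.card W =
      Nat.card H.ConnectedComponent + numNonisolatedVertices H := by
  classical
  have hreach : ∀ {a b : W} (_ : H.Walk a b) (ha : ¬ H.IsIsolated a) (hb : ¬ H.IsIsolated b),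
      (removeIsolated H).Reachable ⟨a, ha⟩ ⟨b, hb⟩ := by
    intro a b p
    induction p with
    | nil => exact fun _ _ => Reachable.refl _
    | @cons a c b h p ih =>
      intro ha hb
      have hc : ¬ H.IsIsolated c := h.not_isIsolated_right
      have : (removeIsolated H).Adj ⟨a, ha⟩ ⟨c, hc⟩ := h
      exact this.reachable.trans (ih hc hb)
  let F : (removeIsolated H).ConnectedComponent ⊕ {w // H.IsIsolated w} → H.ConnectedComponent :=
    Sum.elim (ConnectedComponent.map (SimpleGraph.Embedding.induce _).toHom)
      (fun w => H.connectedComponentMk w.1)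
  have hiso : ∀ {a b : W}, H.IsIsolated a → H.Reachable a b → a = b := by
    rintro a b ha ⟨p⟩
    cases p with
    | nil => rfl
    | cons h p => exact absurd h (ha _)
  have hF : Function.Bijective F := by
    constructor
    · rintro (c | ⟨a, ha⟩) (d | ⟨b, hb⟩) h
      · induction c using ConnectedComponent.ind with | _ c =>
        induction d using ConnectedComponent.ind with | _ d =>
        obtain ⟨p⟩ := ConnectedComponent.exact h
        exact congrArg _ (ConnectedComponent.sound (hreach p c.2 d.2))
      · induction c using ConnectedComponent.ind with | _ c =>
        have : b = c.1 := hiso hb (ConnectedComponent.exact h).symm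
        exact absurd (this ▸ hb) c.2
      · induction d using ConnectedComponent.ind with | _ d =>
        have : a = d.1 := hiso ha (ConnectedComponent.exact h)
        exact absurd (this ▸ ha) d.2
      · have : a = b := hiso ha (ConnectedComponent.exact h)
        subst this; rfl
    · intro c
      induction c using ConnectedComponent.ind with | _ v =>
      by_cases hv : H.IsIsolated v
      · exact ⟨Sum.inr ⟨v, hv⟩, rfl⟩
      · exact ⟨Sum.inl ((removeIsolated H).connectedComponentMk ⟨v, hv⟩), rfl⟩
  have h1 := Nat.card_congr (Equiv.ofBijective F hF)
  have h2 := Nat.card_congr (Equiv.sumCompl (fun w => H.IsIsolated w))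
  rw [Nat.card_sum] at h1 h2
  have h3 : Nat.card {w // ¬ H.IsIsolated w} = numNonisolatedVertices H := rfl
  have h4 : Nat.card (removeIsolated H).ConnectedComponent = numNonisolatedComponents H := rfl
  omega

/-- For a spanning subgraph, having as many components as the whole graph can be tested after
removing isolated vertices. -/
theorem card_connectedComponent_eq_iff_of_le {W : Type*} [Finite W] {H G : SimpleGraph W}
    (hle : H ≤ G) : Nat.card G.ConnectedComponent = Nat.card H.ConnectedComponent ↔
      numNonisolatedComponents G = numNonisolatedComponents H ∧
        numNonisolatedVertices G = numNonisolatedVertices H := by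
  have hG := numNonisolatedComponents_add_card G
  have hH := numNonisolatedComponents_add_card H
  constructor
  · intro h
    -- The map on components is always onto, so equal counts make it injective; a neighbour in `G`
    -- is then reachable in `H`, and both graphs have the same isolated vertices.
    have hbij : Function.Bijective (ConnectedComponent.map (Hom.ofLE hle)) :=
      (Nat.bijective_iff_surjective_and_card _).2
        ⟨ConnectedComponent.surjective_map_ofLE hle, h.symm⟩
    have hset : ∀ w, ¬ G.IsIsolated w ↔ ¬ H.IsIsolated w := by
      intro w
      constructor
      · intro hw
        obtain ⟨u, hu⟩ := exists_adj_iff_not_isIsolated.2 hw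
        have : H.connectedComponentMk w = H.connectedComponentMk u :=
          hbij.1 (ConnectedComponent.sound hu.reachable)
        obtain ⟨p⟩ := ConnectedComponent.exact this
        cases p with
        | nil => exact absurd rfl hu.ne
        | cons h p => exact h.not_isIsolated_left
      · intro hw
        obtain ⟨u, hu⟩ := exists_adj_iff_not_isIsolated.2 hw
        exact (hle hu).not_isIsolated_left
    have : numNonisolatedVertices G = numNonisolatedVertices H := by
      simp only [numNonisolatedVertices, hset]
    exact ⟨by omega, this⟩
  · rintro ⟨h1, h2⟩
    omega

/-! ### Semi-paths as linear forests. -/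

section SemiPath

variable {V : Type*} {G : SimpleGraph V} {P : G.Subgraph}

/-- The vertices of a semi-path can be placed injectively on disjoint number lines such that
adjacent vertices are consecutive. -/
theorem IsSemiPath.exists_injective_consecutive (hP : IsSemiPath P) :
    ∃ φ : V → (P.coe.ConnectedComponent ⊕ V) × ℕ, φ.Injective ∧
      ∀ u v, P.spanningCoe.Adj u v → (φ u).1 = (φ v).1 ∧
        ((φ u).2 + 1 = (φ v).2 ∨ (φ v).2 + 1 = (φ u).2) := by
  classical
  choose k e using hP
  let pos : P.verts → ℕ := fun x => ((e (P.coe.connectedComponentMk x)).some ⟨x, rfl⟩).1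
  have hpos : ∀ (c) (x : P.verts) (hx : x ∈ c), pos x = ((e c).some ⟨x, hx⟩).1 := by
    rintro c x rfl
    rfl
  -- Each component of `P` gets its own line; a vertex outside `P` sits at position 0 of a private
  -- line, which keeps the placement injective.
  refine ⟨fun v => if h : v ∈ P.verts then
    (Sum.inl (P.coe.connectedComponentMk ⟨v, h⟩), pos ⟨v, h⟩) else (Sum.inr v, 0), ?_, ?_⟩
  · intro u v huv
    by_cases hu : u ∈ P.verts <;> by_cases hv : v ∈ P.verts
    · simp only [hu, hv, dite_true, Prod.mk.injEq, Sum.inl.injEq] at huv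
      obtain ⟨h1, h2⟩ := huv
      rw [hpos _ ⟨v, hv⟩ rfl, hpos _ ⟨u, hu⟩ h1] at h2
      have := (e _).some.injective (Fin.ext h2)
      exact congrArg (fun x => x.1.1) this
    · simp [hu, hv] at huv
    · simp [hu, hv] at huv
    · simpa [hu, hv] using huv
  · intro u v huv
    have hu : u ∈ P.verts := P.edge_vert huv
    have hv : v ∈ P.verts := P.edge_vert huv.symm
    have hadj : P.coe.Adj ⟨u, hu⟩ ⟨v, hv⟩ := huv
    have hc : P.coe.connectedComponentMk ⟨u, hu⟩ = P.coe.connectedComponentMk ⟨v, hv⟩ :=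
      ConnectedComponent.sound hadj.reachable
    simp only [hu, hv, dite_true]
    refine ⟨by rw [hc], ?_⟩
    rw [hpos _ ⟨v, hv⟩ rfl, hpos _ ⟨u, hu⟩ hc]
    have : (P.coe.connectedComponentMk ⟨v, hv⟩).toSimpleGraph.Adj ⟨⟨u, hu⟩, hc⟩ ⟨⟨v, hv⟩, rfl⟩ :=
      hadj
    exact pathGraph_adj.1 ((e (P.coe.connectedComponentMk ⟨v, hv⟩)).some.map_rel_iff.2 this)

theorem IsSemiPath.isAcyclic_spanningCoe (hP : IsSemiPath P) : P.spanningCoe.IsAcyclic :=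
  let ⟨φ, h1, h2⟩ := hP.exists_injective_consecutive
  isAcyclic_of_injective_consecutive φ h1 h2

theorem IsSemiPath.ncard_neighborSet_le_two (hP : IsSemiPath P) (v : V) :
    (P.neighborSet v).ncard ≤ 2 :=
  let ⟨φ, h1, h2⟩ := hP.exists_injective_consecutive
  ncard_neighborSet_le_two_of_injective_consecutive φ h1 h2 v

end SemiPath

/-- Deleting vertices from a subgraph, or from the associated spanning subgraph, leaves the same
graph up to isolated vertices. -/
noncomputable def removeIsolatedDeleteVertsIso {V : Type*} {G : SimpleGraph V} (P : G.Subgraph)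
    (T : Set V) : removeIsolated (P.deleteVerts T).coe ≃g
      removeIsolated (P.spanningCoe.induce Tᶜ) where
  toFun x := ⟨⟨x.1.1, x.1.2.2⟩, by
    obtain ⟨u, hu⟩ := exists_adj_iff_not_isIsolated.2 x.2
    rw [Subgraph.coe_adj, Subgraph.deleteVerts_adj] at hu
    exact exists_adj_iff_not_isIsolated.1 ⟨⟨u.1, u.2.2⟩, hu.2.2.2.2⟩⟩
  invFun x := ⟨⟨x.1.1, by
    obtain ⟨u, hu⟩ := exists_adj_iff_not_isIsolated.2 x.2
    exact ⟨P.edge_vert hu, x.1.2⟩⟩, by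
    obtain ⟨u, hu⟩ := exists_adj_iff_not_isIsolated.2 x.2
    have hu : P.Adj x.1.1 u.1 := hu
    refine exists_adj_iff_not_isIsolated.1 ⟨⟨u.1, P.edge_vert hu.symm, u.2⟩, ?_⟩
    rw [Subgraph.coe_adj, Subgraph.deleteVerts_adj]
    exact ⟨P.edge_vert hu, x.1.2, P.edge_vert hu.symm, u.2, hu⟩⟩
  left_inv _ := rfl
  right_inv _ := rfl
  map_rel_iff' {a b} := by
    change P.Adj a.1.1 b.1.1 ↔ (P.deleteVerts T).Adj a.1.1 b.1.1
    rw [Subgraph.deleteVerts_adj]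
    exact ⟨fun h => ⟨a.1.2.1, a.1.2.2, b.1.2.1, b.1.2.2, h⟩, fun h => h.2.2.2.2⟩

theorem numNonisolatedVertices_deleteVerts {V : Type*} {G : SimpleGraph V} (P : G.Subgraph)
    (T : Set V) : numNonisolatedVertices (P.deleteVerts T).coe =
      numNonisolatedVertices (P.spanningCoe.induce Tᶜ) :=
  Nat.card_congr (removeIsolatedDeleteVertsIso P T).toEquiv

theorem numNonisolatedComponents_deleteVerts {V : Type*} {G : SimpleGraph V} (P : G.Subgraph)
    (T : Set V) : numNonisolatedComponents (P.deleteVerts T).coe =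
      numNonisolatedComponents (P.spanningCoe.induce Tᶜ) :=
  Nat.card_congr (removeIsolatedDeleteVertsIso P T).connectedComponentEquiv

/-! ### Counting the edges that meet a vertex set. -/

namespace SimpleGraph

variable {V : Type*} [Fintype V] [DecidableEq V] (H : SimpleGraph V) [DecidableRel H.Adj]

/-- The edges of `H` are those avoiding `T` and those incident to `T`. -/
theorem ncard_edgeSet_induce_compl_add_card_biUnion (T : Finset V) :
    (H.induce (T : Set V)ᶜ).edgeSet.ncard + (T.biUnion fun v => H.incidenceFinset v).card =
      H.edgeSet.ncard := by
  have h1 : (H.induce (T : Set V)ᶜ).edgeSet.ncard =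
      (H.edgeSet \ ((T.biUnion fun v => H.incidenceFinset v : Finset (Sym2 V)) : Set (Sym2 V))).ncard := by
    rw [← Set.ncard_image_of_injective _ (Sym2.map.injective Subtype.val_injective)]
    congr 1
    ext e
    induction e with | h u v =>
    simp only [Set.mem_image, Set.mem_sdiff, mem_edgeSet, Finset.coe_biUnion, Set.mem_iUnion,
      Finset.mem_coe, mem_incidenceFinset, mk'_mem_incidenceSet_iff]
    constructor
    · rintro ⟨e, he, heq⟩
      induction e with | h a b =>
      have hab : H.Adj a.1 b.1 := he
      have ha : a.1 ∉ T := a.2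
      have hb : b.1 ∉ T := b.2
      rw [Sym2.map_mk, Sym2.eq_iff] at heq
      rcases heq with ⟨rfl, rfl⟩ | ⟨rfl, rfl⟩
      · refine ⟨hab, ?_⟩
        rintro ⟨c, hc, -, rfl | rfl⟩
        · exact ha hc
        · exact hb hc
      · refine ⟨hab.symm, ?_⟩
        rintro ⟨c, hc, -, rfl | rfl⟩
        · exact hb hc
        · exact ha hc
    · rintro ⟨h, hn⟩
      refine ⟨s(⟨u, fun hu => hn ⟨u, hu, h, Or.inl rfl⟩⟩, ⟨v, fun hv => hn ⟨v, hv, h, Or.inr rfl⟩⟩),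
        h, rfl⟩
  rw [h1, ← Set.ncard_coe_finset]
  refine Set.ncard_sdiff_add_ncard_of_subset ?_ (Set.toFinite _)
  intro e he
  simp only [Finset.coe_biUnion, Set.mem_iUnion, Finset.mem_coe, mem_incidenceFinset] at he
  obtain ⟨v, -, hv⟩ := he
  exact hv.1

theorem card_biUnion_incidenceFinset_le (T : Finset V) :
    (T.biUnion fun v => H.incidenceFinset v).card ≤ ∑ v ∈ T, H.degree v := by
  simpa using Finset.card_biUnion_le (s := T) (t := fun v => H.incidenceFinset v)

/-- The degree sum overcounts exactly when some edge lies in two of the incidence sets, that is,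
when it has both ends in `T`. -/
theorem card_biUnion_incidenceFinset_eq_iff (T : Finset V) :
    (T.biUnion fun v => H.incidenceFinset v).card = ∑ v ∈ T, H.degree v ↔
      ∀ v ∈ T, ∀ w ∈ T, ¬ H.Adj v w := by
  constructor
  · intro h v hv w hw hvw
    have hw' : w ∈ T.erase v := Finset.mem_erase.2 ⟨hvw.ne', hw⟩
    have h1 : (T.biUnion fun v => H.incidenceFinset v) =
        H.incidenceFinset v ∪ (T.erase v).biUnion (fun v => H.incidenceFinset v) := by
      conv_lhs => rw [← Finset.insert_erase hv, Finset.biUnion_insert]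
    have h2 := Finset.card_union_add_card_inter (H.incidenceFinset v)
      ((T.erase v).biUnion fun v => H.incidenceFinset v)
    have h3 := card_biUnion_incidenceFinset_le H (T.erase v)
    have h4 := Finset.add_sum_erase T (fun v => H.degree v) hv
    have h5 : 0 < (H.incidenceFinset v ∩ (T.erase v).biUnion fun v => H.incidenceFinset v).card := by
      refine Finset.card_pos.2 ⟨s(v, w), Finset.mem_inter.2 ⟨?_, Finset.mem_biUnion.2 ⟨w, hw', ?_⟩⟩⟩
      · rw [mem_incidenceFinset, mk'_mem_incidenceSet_iff]; exact ⟨hvw, Or.inl rfl⟩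
      · rw [mem_incidenceFinset, mk'_mem_incidenceSet_iff]; exact ⟨hvw, Or.inr rfl⟩
    rw [card_incidenceFinset_eq_degree, ← h1] at h2
    omega
  · intro h
    rw [Finset.card_biUnion]
    · simp
    · intro v hv w hw hvw
      refine Finset.disjoint_left.2 ?_
      intro e he1 he2
      rw [mem_incidenceFinset] at he1 he2
      have : e = s(v, w) := (Sym2.mem_and_mem_iff hvw).1 ⟨he1.2, he2.2⟩
      subst this
      exact h v hv w hw he1.1

end SimpleGraph

/-! ### The upper bound for semi-paths and its equality case. -/

section Count

variable {V : Type*} [Finite V] {G : SimpleGraph V} {P : G.Subgraph}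

/-- The number of edges of a semi-path is at most `n + |T| - c(G ∖ T)` for every vertex set `T`;
equality is characterised by degrees, independence and components. -/
theorem IsSemiPath.ncard_edgeSet_add_card_le (hP : IsSemiPath P) (T : Set V) :
    P.edgeSet.ncard + Nat.card (G.induce Tᶜ).ConnectedComponent ≤ Nat.card V + T.ncard ∧
    (P.edgeSet.ncard + Nat.card (G.induce Tᶜ).ConnectedComponent = Nat.card V + T.ncard ↔
      (∀ v ∈ T, v ∈ P.verts ∧ (P.neighborSet v).ncard = 2) ∧
        (∀ v ∈ T, ∀ w ∈ T, ¬ P.Adj v w) ∧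
        numNonisolatedComponents (G.induce Tᶜ) =
          numNonisolatedComponents (P.deleteVerts T).coe ∧
        numNonisolatedVertices (G.induce Tᶜ) =
          numNonisolatedVertices (P.deleteVerts T).coe) := by
  classical
  have := Fintype.ofFinite V
  obtain ⟨S, rfl⟩ : ∃ S : Finset V, (S : Set V) = T := ⟨T.toFinset, by simp⟩
  rw [numNonisolatedComponents_deleteVerts, numNonisolatedVertices_deleteVerts]
  have hle : P.spanningCoe.induce (S : Set V)ᶜ ≤ G.induce (S : Set V)ᶜ := fun _ _ h => P.adj_sub h
  rw [← card_connectedComponent_eq_iff_of_le hle]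
  have hc := ConnectedComponent.card_le_card_of_le hle
  have hforest := (hP.isAcyclic_spanningCoe.induce (S : Set V)ᶜ)
    |>.ncard_edgeSet_add_card_connectedComponent
  have hE : _ = P.edgeSet.ncard := P.spanningCoe.ncard_edgeSet_induce_compl_add_card_biUnion S
  have hB := P.spanningCoe.card_biUnion_incidenceFinset_le S
  have hBeq := P.spanningCoe.card_biUnion_incidenceFinset_eq_iff S
  have hdeg : ∀ v, P.spanningCoe.degree v = (P.neighborSet v).ncard := by
    intro v
    rw [← card_neighborFinset_eq_degree, ← Set.ncard_coe_finset, coe_neighborFinset]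
    rfl
  have hD : ∑ v ∈ S, P.spanningCoe.degree v ≤ ∑ v ∈ S, 2 :=
    Finset.sum_le_sum fun v _ => (hdeg v).trans_le (hP.ncard_neighborSet_le_two v)
  have hDeq := Finset.sum_eq_sum_iff_of_le (s := S) (f := fun v => P.spanningCoe.degree v)
    (g := fun _ => 2) fun v _ => (hdeg v).trans_le (hP.ncard_neighborSet_le_two v)
  have h2 : ∑ v ∈ S, 2 = 2 * S.card := by simp [mul_comm]
  have hcard : Nat.card ((S : Set V)ᶜ : Set V) + S.card = Nat.card V := by
    rw [← Set.ncard_coe_finset, Nat.card_coe_set_eq, add_comm, Set.ncard_add_ncard_compl]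
  have hdeg2 : (∀ v ∈ (S : Set V), v ∈ P.verts ∧ (P.neighborSet v).ncard = 2) ↔
      ∀ v ∈ S, P.spanningCoe.degree v = 2 := by
    refine forall₂_congr fun v _ => ?_
    rw [hdeg]
    refine ⟨fun h => h.2, fun h => ⟨?_, h⟩⟩
    obtain ⟨u, hu⟩ := Set.nonempty_of_ncard_ne_zero (h.trans_ne two_ne_zero)
    exact P.edge_vert hu
  have hind : (∀ v ∈ (S : Set V), ∀ w ∈ (S : Set V), ¬ P.Adj v w) ↔
      ∀ v ∈ S, ∀ w ∈ S, ¬ P.spanningCoe.Adj v w := Iff.rfl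
  rw [hdeg2, hind, ← hBeq, ← hDeq, Set.ncard_coe_finset]
  simp only [h2] at *
  -- The bound is the sum of three inequalities, from the incidence count, the degrees and the
  -- component counts, so it is an equality exactly when all three are.
  refine ⟨by omega, ?_⟩
  omega

end Count

/-! ### The height of the binomial edge ideal. -/

open MvPolynomial

/-- A choice of representatives of the components of `G ∖ S`, fixing `S` pointwise. -/
theorem SimpleGraph.exists_componentRep {V : Type*} [Finite V] (G : SimpleGraph V)
    (S : Finset V) : ∃ f : V → V, (∀ v ∈ S, f v = v) ∧ (∀ v ∉ S, f v ∉ S) ∧ (∀ v, f (f v) = f v) ∧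
      (∀ v w (hv : v ∉ S) (hw : w ∉ S),
        f v = f w ↔ (G.induce (S : Set V)ᶜ).Reachable ⟨v, hv⟩ ⟨w, hw⟩) ∧
      (Set.range f).ncard = S.card + Nat.card (G.induce (S : Set V)ᶜ).ConnectedComponent := by
  classical
  let r : (G.induce (S : Set V)ᶜ).ConnectedComponent → ((S : Set V)ᶜ : Set V) := Quot.out
  have hr : ∀ c, SimpleGraph.connectedComponentMk _ (r c) = c := Quot.out_eq
  have hrS : ∀ c, (r c).1 ∉ S := fun c => (r c).2
  have hrinj : Function.Injective fun c => (r c).1 := fun c d h => by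
    rw [← hr c, ← hr d, Subtype.ext h]
  let f : V → V := fun v => if h : v ∈ S then v else (r (SimpleGraph.connectedComponentMk _ ⟨v, h⟩)).1
  have hfS : ∀ v ∈ S, f v = v := fun v hv => by simp [f, hv]
  have hfn : ∀ v (hv : v ∉ S), f v = (r (SimpleGraph.connectedComponentMk _ ⟨v, hv⟩)).1 :=
    fun v hv => by simp [f, hv]
  have hfr : ∀ c, f (r c).1 = (r c).1 := fun c => by
    rw [hfn _ (hrS c)]
    exact congrArg (fun c => (r c).1) (hr c)
  refine ⟨f, hfS, ?_, ?_, ?_, ?_⟩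
  · intro v hv
    rw [hfn v hv]
    exact hrS _
  · intro v
    by_cases hv : v ∈ S
    · rw [hfS v hv, hfS v hv]
    · rw [hfn v hv, hfr]
  · intro v w hv hw
    rw [hfn v hv, hfn w hw]
    exact ⟨fun h => SimpleGraph.ConnectedComponent.exact (hrinj h),
      fun h => congrArg (fun c => (r c).1) (SimpleGraph.ConnectedComponent.sound h)⟩
  · have hrange : Set.range f = (S : Set V) ∪ Set.range fun c => (r c).1 := by
      ext x
      constructor
      · rintro ⟨v, rfl⟩
        by_cases hv : v ∈ S
        · left; rwa [hfS v hv]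
        · right; exact ⟨_, (hfn v hv).symm⟩
      · rintro (hx | ⟨c, rfl⟩)
        · exact ⟨x, hfS x hx⟩
        · exact ⟨_, hfr c⟩
    have hdisj : Disjoint (S : Set V) (Set.range fun c => (r c).1) := by
      rw [Set.disjoint_right]
      rintro _ ⟨c, rfl⟩
      exact hrS c
    rw [hrange, Set.ncard_union_eq hdisj, Set.ncard_coe_finset, ← Set.image_univ,
      Set.ncard_image_of_injective _ hrinj, Set.ncard_univ]

section Height

variable {K : Type*} [Field K] {V : Type*}

theorem mul_eq_mul_of_adj [LinearOrder V] {G : SimpleGraph V} {L : Type*} [CommRing L] [Algebra K L]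
    (φ : MvPolynomial (V ⊕ V) K →ₐ[K] L) (h : binomialEdgeIdeal K G ≤ RingHom.ker φ) {v w : V}
    (hvw : G.Adj v w) : φ (X (Sum.inl v)) * φ (X (Sum.inr w)) =
      φ (X (Sum.inl w)) * φ (X (Sum.inr v)) := by
  have key : ∀ i j : V, i < j → G.Adj i j → φ (X (Sum.inl i)) * φ (X (Sum.inr j)) =
      φ (X (Sum.inl j)) * φ (X (Sum.inr i)) := by
    intro i j hij hadj
    have := h (Ideal.subset_span ⟨i, j, hij, hadj, rfl⟩)
    rw [RingHom.mem_ker, map_sub, map_mul, map_mul, sub_eq_zero] at this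
    exact this
  rcases lt_trichotomy v w with hlt | rfl | hlt
  · exact key v w hlt hvw
  · rfl
  · exact (key w v hlt hvw.symm).symm

/-- Replaces a prime by a point over a field, where the binomials say that the vectors `(x_v, y_v)`
of adjacent vertices are proportional. -/
theorem exists_algHom_ker_eq {R : Type*} [CommRing R] [Algebra K R] (Q : Ideal R) [Q.IsPrime] :
    ∃ φ : R →ₐ[K] FractionRing (R ⧸ Q), RingHom.ker φ = Q := by
  refine ⟨(IsScalarTower.toAlgHom K (R ⧸ Q) (FractionRing (R ⧸ Q))).comp (Ideal.Quotient.mkₐ K Q),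
    ?_⟩
  ext x
  simp [RingHom.mem_ker, Ideal.Quotient.eq_zero_iff_mem]

/-- A prime containing `J_G` has height at least `n + |S| - c(G ∖ S)` for the set `S` of those `v`
with `X_v` and `Y_v` in the prime. -/
theorem exists_card_add_le_height_add_of_isPrime [LinearOrder V] [Finite V] (G : SimpleGraph V)
    (Q : Ideal (MvPolynomial (V ⊕ V) K)) [Q.IsPrime] (hQ : binomialEdgeIdeal K G ≤ Q) :
    ∃ S : Finset V, (Nat.card V + S.card : ℕ∞) ≤
      Q.height + Nat.card (G.induce (S : Set V)ᶜ).ConnectedComponent := by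
  classical
  have := Fintype.ofFinite V
  obtain ⟨φ, hφ⟩ := exists_algHom_ker_eq (K := K) Q
  let S : Finset V := {v | φ (X (Sum.inl v)) = 0 ∧ φ (X (Sum.inr v)) = 0}
  have hS : ∀ v, v ∈ S ↔ φ (X (Sum.inl v)) = 0 ∧ φ (X (Sum.inr v)) = 0 := fun v => by simp [S]
  obtain ⟨f, hfS, hfn, hff, hreach, hcard⟩ := G.exists_componentRep S
  -- Outside `S` every vector is nonzero, so proportionality is transitive along walks.
  have hwalk : ∀ {a b : ((S : Set V)ᶜ : Set V)}, (G.induce (S : Set V)ᶜ).Walk a b →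
      ∃ t, φ (X (Sum.inl b.1)) = t * φ (X (Sum.inl a.1)) ∧
        φ (X (Sum.inr b.1)) = t * φ (X (Sum.inr a.1)) := by
    intro a b p
    induction p with
    | nil => exact ⟨1, by simp⟩
    | @cons a c b h p ih =>
      obtain ⟨t, h1, h2⟩ := ih
      have ha : ¬ (φ (X (Sum.inl a.1)) = 0 ∧ φ (X (Sum.inr a.1)) = 0) := fun h => a.2 ((hS _).2 h)
      rw [not_and_or] at ha
      obtain ⟨s, h3, h4⟩ := exists_smul_of_mul_eq_mul ha
        (mul_eq_mul_of_adj φ (hQ.trans_eq hφ.symm) (show G.Adj a.1 c.1 from h))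
      exact ⟨t * s, by rw [h1, h3, mul_assoc], by rw [h2, h4, mul_assoc]⟩
  have ht : ∀ v, ∃ t, v ∉ S → φ (X (Sum.inl v)) = t * φ (X (Sum.inl (f v))) ∧
      φ (X (Sum.inr v)) = t * φ (X (Sum.inr (f v))) := by
    intro v
    by_cases hv : v ∈ S
    · exact ⟨0, fun h => absurd hv h⟩
    · obtain ⟨p⟩ := (hreach (f v) v (hfn v hv) hv).1 (hff v)
      obtain ⟨t, ht⟩ := hwalk p
      exact ⟨t, fun _ => ht⟩
  choose t ht using ht
  have hle : RingHom.ker (blockSubst K f S S) ≤ Q := by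
    rw [← hφ]
    exact ker_blockSubst_le S φ (fun v hv => (hS v).1 hv) t (fun c => φ (X (Sum.inl c)))
      (fun c => φ (X (Sum.inr c))) ht
  have h1 := le_height_ker_blockSubst (K := K) f S (fun v hv w hw => by
    rw [hfS v hv] at hw
    by_cases hwS : w ∈ S
    · rwa [hfS w hwS] at hw
    · exact absurd (hw ▸ hv) (hfn w hwS))
  have h2 := Ideal.height_mono hle
  refine ⟨S, ?_⟩
  rw [hcard] at h1
  -- The elements of `S` are themselves blocks, so one `|S|` cancels from the bound `n + 2|S|`.
  have h3 : ((S.card : ℕ) : ℕ∞) ≠ ⊤ := ENat.natCast_ne_top _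
  rw [← ENat.add_le_add_iff_right h3]
  calc (Nat.card V + S.card + S.card : ℕ∞) = Nat.card V + 2 * S.card := by ring
    _ ≤ _ := h1
    _ ≤ Q.height + _ := by gcongr
    _ = _ := by push_cast; ring

theorem exists_card_add_le_height_add [LinearOrder V] [Finite V] (G : SimpleGraph V) :
    ∃ S : Finset V, (Nat.card V + S.card : ℕ∞) ≤
      (binomialEdgeIdeal K G).height + Nat.card (G.induce (S : Set V)ᶜ).ConnectedComponent := by
  cases hI : (binomialEdgeIdeal K G).height with
  | top => exact ⟨∅, by simp⟩
  | coe m =>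
    obtain ⟨Q, hQ, hle, hm⟩ := Ideal.exists_isPrime_height_eq hI
    rw [← hm]
    exact exists_card_add_le_height_add_of_isPrime G Q hle

/-- The height of `J_G` is at most `n + |S| - c(G ∖ S)` for every vertex set `S`. -/
theorem height_binomialEdgeIdeal_add_le [LinearOrder V] [Finite V] (G : SimpleGraph V)
    (S : Finset V) : (binomialEdgeIdeal K G).height +
      Nat.card (G.induce (S : Set V)ᶜ).ConnectedComponent ≤ Nat.card V + S.card := by
  classical
  have := Fintype.ofFinite V
  obtain ⟨f, hfS, hfn, hff, hreach, hcard⟩ := G.exists_componentRep S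
  have hprime := RingHom.ker_isPrime (blockSubst K f S S)
  have hJ : binomialEdgeIdeal K G ≤ RingHom.ker (blockSubst K f S S) := by
    refine Ideal.span_le.2 ?_
    rintro _ ⟨i, j, -, hij, rfl⟩
    rw [SetLike.mem_coe, RingHom.mem_ker]
    simp only [map_sub, map_mul, blockSubst_X_inl, blockSubst_X_inr]
    by_cases hi : i ∈ S
    · simp [hi]
    by_cases hj : j ∈ S
    · simp [hj]
    have hadj : (G.induce (S : Set V)ᶜ).Adj ⟨i, hi⟩ ⟨j, hj⟩ := hij
    simp only [hi, hj, if_false, (hreach i j hi hj).2 hadj.reachable]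
    ring
  -- The non-representatives: one binomial for each, with the `2|S|` variables, gives at most `n +
  -- |S| - c(G ∖ S)` generators. They need not generate the kernel; it suffices that it is minimal
  -- over them.
  let M : Finset V := {v | f v ≠ v}
  let gens : Finset (MvPolynomial (V ⊕ V) K) := S.image (fun v => X (Sum.inl v)) ∪
    S.image (fun v => X (Sum.inr v)) ∪ M.image (fun v =>
      X (Sum.inl (f v)) * X (Sum.inr v) - X (Sum.inl v) * X (Sum.inr (f v)))
  have hgens : gens.card ≤ S.card + S.card + M.card :=
    (Finset.card_union_le _ _).trans (add_le_add ((Finset.card_union_le _ _).trans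
      (add_le_add Finset.card_image_le Finset.card_image_le)) Finset.card_image_le)
  have hM : M.card + (Set.range f).ncard = Nat.card V := by
    have : Set.range f = ((Finset.univ.filter fun v => f v = v : Finset V) : Set V) := by
      ext v
      simp only [Set.mem_range, Finset.coe_filter, Finset.mem_univ, true_and, Set.mem_ofPred_eq]
      exact ⟨fun ⟨w, hw⟩ => hw ▸ hff w, fun h => ⟨v, h⟩⟩
    rw [this, Set.ncard_coe_finset, Nat.card_eq_fintype_card, ← Finset.card_univ, add_comm]
    exact Finset.card_filter_add_card_filter_not (s := Finset.univ) (fun v => f v = v)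
  have hmin : RingHom.ker (blockSubst K f S S) ∈ (Ideal.span (gens : Set _)).minimalPrimes := by
    refine ⟨⟨hprime, Ideal.span_le.2 ?_⟩, ?_⟩
    · intro x hx
      simp only [gens, Finset.coe_union, Finset.coe_image, Set.mem_union, Set.mem_image,
        Finset.mem_coe] at hx
      rw [SetLike.mem_coe, RingHom.mem_ker]
      rcases hx with (⟨v, hv, rfl⟩ | ⟨v, hv, rfl⟩) | ⟨v, hv, rfl⟩
      · simp [blockSubst_X_inl, hv]
      · simp [blockSubst_X_inr, hv]
      · have hv : f v ≠ v := by simpa [M] using hv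
        have hvS : v ∉ S := fun h => hv (hfS v h)
        simp only [map_sub, map_mul, blockSubst_X_inl, blockSubst_X_inr, hvS, hfn v hvS, hff,
          if_false]
        ring
    · rintro Q ⟨hQ, hgQ⟩ hle
      obtain ⟨φ, hφ⟩ := exists_algHom_ker_eq (K := K) Q
      have hzero : ∀ x ∈ gens, φ x = 0 := fun x hx => by
        rw [← RingHom.mem_ker, hφ]
        exact hgQ (Ideal.subset_span hx)
      have ht : ∀ v, ∃ t, v ∉ S → φ (X (Sum.inl v)) = t * φ (X (Sum.inl (f v))) ∧
          φ (X (Sum.inr v)) = t * φ (X (Sum.inr (f v))) := by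
        intro v
        by_cases hv : v ∈ S
        · exact ⟨0, fun h => absurd hv h⟩
        -- Here `Q` lies inside the kernel, which does not contain `X_{f v}`; so the vector at each
        -- representative is nonzero modulo `Q`.
        have hne : φ (X (Sum.inl (f v))) ≠ 0 := by
          intro h0
          rw [← RingHom.mem_ker, hφ] at h0
          have := hle h0
          rw [RingHom.mem_ker, blockSubst_X_inl, if_neg (hfn v hv)] at this
          exact mul_ne_zero (X_ne_zero _) (X_ne_zero _) this
        have heq : φ (X (Sum.inl (f v))) * φ (X (Sum.inr v)) =
            φ (X (Sum.inl v)) * φ (X (Sum.inr (f v))) := by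
          by_cases hfv : f v = v
          · rw [hfv]
          · rw [← sub_eq_zero, ← map_mul, ← map_mul, ← map_sub]
            refine hzero _ (Finset.mem_union_right _ (Finset.mem_image_of_mem _ ?_))
            simp [M, hfv]
        obtain ⟨t, ht⟩ := exists_smul_of_mul_eq_mul (Or.inl hne) heq
        exact ⟨t, fun _ => ht⟩
      choose t ht using ht
      rw [← hφ]
      exact ker_blockSubst_le S φ (fun v hv =>
        ⟨hzero _ (Finset.mem_union_left _ (Finset.mem_union_left _ (Finset.mem_image_of_mem _ hv))),
          hzero _ (Finset.mem_union_left _ (Finset.mem_union_right _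
            (Finset.mem_image_of_mem _ hv)))⟩) t (fun c => φ (X (Sum.inl c)))
        (fun c => φ (X (Sum.inr c))) ht
  have hht := (Ideal.height_mono hJ).trans (Ideal.height_le_card_of_mem_minimalPrimes_span_finset hmin)
  calc _ ≤ (gens.card + Nat.card (G.induce (S : Set V)ᶜ).ConnectedComponent : ℕ∞) := by gcongr
    _ ≤ _ := by
      norm_cast
      omega

end Height

/-! ### Comparing the packing number with the height. -/

theorem IsSemiPath.ncard_edgeSet_le_pathPackingNumber {V : Type*} [Finite V] {G : SimpleGraph V}
    {P : G.Subgraph} (hP : IsSemiPath P) : P.edgeSet.ncard ≤ pathPackingNumber G :=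
  le_csSup (pathPackingNumber_set_bddAbove G) ⟨P, hP, rfl⟩

theorem exists_isSemiPath_pathPackingNumber_eq {V : Type*} [Finite V] (G : SimpleGraph V) :
    ∃ P : G.Subgraph, IsSemiPath P ∧ pathPackingNumber G = P.edgeSet.ncard :=
  Nat.sSup_mem (pathPackingNumber_set_nonempty G) (pathPackingNumber_set_bddAbove G)

theorem mainTheorem3 (K : Type*) [Field K] {n : ℕ} (G : SimpleGraph (Fin n)) :
    IsKonigType K G ↔
      ∃ (P : G.Subgraph) (T : Set (Fin n)),
        IsSemiPath P ∧
        pathPackingNumber G = P.edgeSet.ncard ∧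
        (∀ v ∈ T, v ∈ P.verts ∧ (P.neighborSet v).ncard = 2) ∧
        (∀ v ∈ T, ∀ w ∈ T, ¬ P.Adj v w) ∧
        numNonisolatedComponents (G.induce Tᶜ) =
          numNonisolatedComponents (P.deleteVerts T).coe ∧
        numNonisolatedVertices (G.induce Tᶜ) =
          numNonisolatedVertices (P.deleteVerts T).coe := by
  classical
  -- This `S` attains the height. It serves as `T` in the forward direction; in the converse it
  -- gives `|E(P)| ≤ ht J_G`, while the given `T` yields the reverse inequality.
  obtain ⟨S, hS⟩ := exists_card_add_le_height_add (K := K) G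
  constructor
  · intro hK
    obtain ⟨P, hP, hr⟩ := exists_isSemiPath_pathPackingNumber_eq G
    obtain ⟨hle, heq⟩ := hP.ncard_edgeSet_add_card_le (S : Set (Fin n))
    refine ⟨P, S, hP, hr, heq.1 (hle.antisymm ?_)⟩
    rw [← show _ = _ from hK, hr] at hS
    rw [Set.ncard_coe_finset]
    exact_mod_cast hS
  · rintro ⟨P, T, hP, hr, hT⟩
    have h1 := (hP.ncard_edgeSet_add_card_le T).2.2 hT
    have h2 := height_binomialEdgeIdeal_add_le (K := K) G T.toFinset
    rw [Set.coe_toFinset, ← Set.ncard_eq_toFinset_card', ← Nat.cast_add, ← h1, Nat.cast_add,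
      ENat.add_le_add_iff_right (ENat.natCast_ne_top _)] at h2
    have h3 := (hP.ncard_edgeSet_add_card_le (S : Set (Fin n))).1
    rw [Set.ncard_coe_finset] at h3
    have h4 := (Nat.cast_le (α := ℕ∞).2 h3).trans ((Nat.cast_add _ _).trans_le hS)
    rw [Nat.cast_add, ENat.add_le_add_iff_right (ENat.natCast_ne_top _)] at h4
    rw [IsKonigType, hr]
    exact le_antisymm h4 h2
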